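/- Let $T$ be a sink tree on the vertex set $[n]$ with root $z$, i.e. a rooted tree with root $z$ all of whose edges are oriented toward $z$, and let $\tilde T$ be the source tree obtained from $T$ by reversing the orientation of every edge. For a digraph $D$ on $[n]$, a sequence $s\in[n]^m$ is a parking function on $D$ if it is possible for $m$ cars, entering one after another, all to park by the following rule: car $i$ starts at vertex $s_i$; whenever the vertex where a car currently stands is unoccupied it parks there, and otherwise it drives along an outgoing edge of its choice and repeats (failing to park if it never finds an unoccupied vertex). Let $P(D,m)$ be the number of parking functions with $m$ cars on $D$. Let $N(z)$ be the set of vertices adjacent to $z$, and let $\mathrm{minleafdist}(T)$ be the number of vertices (both ends included) in a shortest path, in the underlying undirected tree, from a leaf (a vertex of degree one) to a vertex of degree at least three, with $\mathrm{minleafdist}(T)=\infty$ if $T$ has no vertex of degree at least three. If $$2\le m\le \min\bigl(|N(z)|,\ \mathrm{minleafdist}(T)\bigr),$$ then $$P(T,m)>P(\tilde T,m).$$ -/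

import Mathlib

namespace DigraphParking

variable {V : Type*}

/-- `CarParks D occ u w`: when the occupied vertices are those of `occ`, a car that is currently at
`u` can end up parking at `w`. It parks where it is if that vertex is free; otherwise it drives
along some edge of `D` (of its choice) and repeats. -/
inductive CarParks (D : Digraph V) (occ : Set V) : V → V → Prop
  | park {u : V} (hu : u ∉ occ) : CarParks D occ u u
  | drive {u v w : V} (hu : u ∈ occ) (huv : D.Adj u v) (hw : CarParks D occ v w) :
      CarParks D occ u w

/-- `AllCarsPark D occ s`: starting from the occupied set `occ`, it is possible for the cars with
successive preferences `s` to park one after another. -/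
inductive AllCarsPark (D : Digraph V) : Set V → List V → Prop
  | nil (occ : Set V) : AllCarsPark D occ []
  | cons {occ : Set V} {u w : V} {s : List V} (hw : CarParks D occ u w)
      (hs : AllCarsPark D (insert w occ) s) : AllCarsPark D occ (u :: s)

/-- `s` is a parking function with `m` cars on `D`. -/
def IsParkingFunction (D : Digraph V) {m : ℕ} (s : Fin m → V) : Prop :=
  AllCarsPark D ∅ (List.ofFn s)

/-- `P(D, m)`: the number of parking functions with `m` cars on `D`. -/
noncomputable def numParking (D : Digraph V) (m : ℕ) : ℕ :=
  {s : Fin m → V | IsParkingFunction D s}.ncard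

/-- The digraph with all edges reversed. -/
def reversal (D : Digraph V) : Digraph V where
  Adj u v := D.Adj v u

/-- The underlying undirected graph. -/
abbrev underlying (D : Digraph V) : SimpleGraph V := D.toSimpleGraphInclusive

/-- `D` is a sink tree with root `z`: the underlying graph is a tree, and every edge is oriented
toward `z`, i.e. it leads from a vertex to one that is one step closer to `z`. -/
def IsSinkTree (D : Digraph V) (z : V) : Prop :=
  (underlying D).IsTree ∧
    ∀ u v, D.Adj u v → (underlying D).dist u z = (underlying D).dist v z + 1

/-- `N(v)`: the vertices adjacent to `v`, regardless of orientation. -/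
def nbhd (D : Digraph V) (v : V) : Set V := (underlying D).neighborSet v

/-- The (undirected) degree of a vertex. -/
noncomputable def deg (D : Digraph V) (v : V) : ℕ := (nbhd D v).ncard

/-- The number of vertices in a shortest path from a leaf to a vertex of degree at least three
(both ends counted); it is `⊤` if there is no vertex of degree at least three. -/
noncomputable def minleafdist (D : Digraph V) : ℕ∞ :=
  ⨅ (l : V) (_ : deg D l = 1) (v : V) (_ : 3 ≤ deg D v), (underlying D).edist l v + 1

end DigraphParking

namespace DigraphParking

open Classical in
/-- In a set that cannot be left, at most as many cars can start as there are free vertices. -/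
theorem AllCarsPark.countP_le {V : Type*} {D : Digraph V} (A : Finset V)
    (hA : ∀ u ∈ A, ∀ v, D.Adj u v → v ∈ A) {occ : Set V} {l : List V}
    (h : AllCarsPark D occ l) : l.countP (· ∈ A) ≤ (A.filter (· ∉ occ)).card := by
  have key : ∀ {occ : Set V} {u w : V}, CarParks D occ u w → w ∉ occ ∧ (u ∈ A → w ∈ A) := by
    intro occ u w h
    induction h with
    | park hu => exact ⟨hu, id⟩
    | drive hu huv _ ih => exact ⟨ih.1, fun h => ih.2 (hA _ h _ huv)⟩
  induction h with
  | nil => simp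
  | @cons occ u w s hw hs ih =>
    obtain ⟨hwo, huw⟩ := key hw
    replace ih : s.countP (· ∈ A) ≤ ((A.filter (· ∉ occ)).erase w).card :=
      ih.trans (Finset.card_le_card fun v => by simp; tauto)
    rw [List.countP_cons]
    by_cases hu : u ∈ A
    · have hmem : w ∈ A.filter (· ∉ occ) := by simp [huw hu, hwo]
      rw [← Finset.card_erase_add_one hmem]
      simp only [hu, decide_true, if_true]
      omega
    · simp only [hu, decide_false, Bool.false_eq_true, if_false, add_zero]
      exact ih.trans (Finset.card_le_card (Finset.erase_subset _ _))

theorem carParks_iterate {V : Type*} {D : Digraph V} {par : V → V} {z : V}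
    (hpar : ∀ u, u ≠ z → D.Adj u (par u)) (hz : par z = z) {occ : Set V} (k : ℕ) :
    ∀ u, par^[k] u ∉ occ → (∀ j < k, par^[j] u ∈ occ) → CarParks D occ u (par^[k] u) := by
  induction k with
  | zero => intro u hu _; exact .park hu
  | succ k ih =>
    intro u hu hj
    have h0 : u ∈ occ := hj 0 (by omega)
    have hne : u ≠ z := by
      rintro rfl
      rw [Function.iterate_fixed hz] at hu
      exact hu h0
    exact .drive h0 (hpar u hne) (ih (par u) hu fun j hjk => hj (j + 1) (by omega))

open Classical in
/-- A Hall condition for parking along the iterates of a map that fixes the sink. -/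
theorem allCarsPark_of_countP_le {V : Type*} [Fintype V] {D : Digraph V} {par : V → V} {z : V}
    (hpar : ∀ u, u ≠ z → D.Adj u (par u)) (hz : par z = z) (l : List V) :
    ∀ occ : Set V, (∀ R : Finset V, (∀ v ∈ R, par v ∈ R) →
      l.countP (· ∈ R) ≤ (R.filter (· ∉ occ)).card) → AllCarsPark D occ l := by
  induction l with
  | nil => intro occ _; exact .nil occ
  | cons u l ih =>
    intro occ h
    let up : Finset V := Finset.univ.filter fun v => ∃ k, par^[k] u = v
    have hup : ∀ v ∈ up, par v ∈ up := by
      intro v hv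
      obtain ⟨k, hk⟩ := (Finset.mem_filter.1 hv).2
      exact Finset.mem_filter.2
        ⟨Finset.mem_univ _, k + 1, by rw [Function.iterate_succ_apply', hk]⟩
    have huup : u ∈ up := Finset.mem_filter.2 ⟨Finset.mem_univ _, 0, rfl⟩
    have hex : ∃ k, par^[k] u ∉ occ := by
      have h1 := h up hup
      rw [List.countP_cons] at h1
      simp only [huup, decide_true, if_true] at h1
      obtain ⟨v, hv⟩ := Finset.card_pos.1 (lt_of_lt_of_le (Nat.succ_pos _) h1)
      obtain ⟨hv, hvo⟩ := Finset.mem_filter.1 hv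
      obtain ⟨k, rfl⟩ := (Finset.mem_filter.1 hv).2
      exact ⟨k, hvo⟩
    obtain ⟨k, hk, hmin⟩ : ∃ k, par^[k] u ∉ occ ∧ ∀ j < k, par^[j] u ∈ occ :=
      ⟨Nat.find hex, Nat.find_spec hex, fun j hj => not_not.1 (Nat.find_min hex hj)⟩
    refine .cons (carParks_iterate hpar hz k u hk hmin) (ih _ fun R hR => ?_)
    set w := par^[k] u with hw
    suffices hs : l.countP (· ∈ R) ≤ ((R.filter (· ∉ occ)).erase w).card from
      hs.trans (Finset.card_le_card fun v => by simp; tauto)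
    by_cases hwR : w ∈ R
    · have hmem : w ∈ R.filter (· ∉ occ) := by simp [hwR, hk]
      have hcl : ∀ v ∈ R ∪ up, par v ∈ R ∪ up := by
        intro v hv
        rcases Finset.mem_union.1 hv with hv | hv
        · exact Finset.mem_union_left _ (hR v hv)
        · exact Finset.mem_union_right _ (hup v hv)
      have hsame : (R ∪ up).filter (· ∉ occ) = R.filter (· ∉ occ) := by
        ext v
        simp only [Finset.mem_filter, Finset.mem_union]
        refine ⟨?_, fun ⟨a, b⟩ => ⟨Or.inl a, b⟩⟩
        rintro ⟨hv | hv, hvo⟩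
        · exact ⟨hv, hvo⟩
        · obtain ⟨j, rfl⟩ := (Finset.mem_filter.1 hv).2
          have hkj : k ≤ j := by
            by_contra hlt
            exact hvo (hmin j (by omega))
          refine ⟨?_, hvo⟩
          have hit : ∀ i, par^[i] w ∈ R := by
            intro i
            induction i with
            | zero => exact hwR
            | succ i ihi => rw [Function.iterate_succ_apply']; exact hR _ ihi
          have h2 := hit (j - k)
          rwa [hw, ← Function.iterate_add_apply, Nat.sub_add_cancel hkj] at h2
      have h1 := h _ hcl
      rw [hsame, List.countP_cons, ← Finset.card_erase_add_one hmem] at h1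
      simp only [Finset.mem_union_right R huup, decide_true, if_true] at h1
      have h2 : l.countP (· ∈ R) ≤ l.countP (· ∈ R ∪ up) := by
        apply List.countP_mono_left
        intro v _ hv
        simp only [decide_eq_true_eq] at hv ⊢
        exact Finset.mem_union_left _ hv
      omega
    · rw [Finset.erase_eq_of_notMem (by simp [hwR])]
      refine le_trans ?_ (h R hR)
      rw [List.countP_cons]
      omega

theorem countP_ofFn_eq_card {V : Type*} (p : V → Prop) [DecidablePred p] {m : ℕ} (s : Fin m → V) :
    (List.ofFn s).countP (fun v => p v) = (Finset.univ.filter fun i => p (s i)).card := by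
  induction m with
  | zero => simp
  | succ m ih =>
    rw [List.ofFn_succ, List.countP_cons, ih, Fin.card_filter_univ_succ]
    by_cases h : p (s 0) <;> simp [h]

end DigraphParking

set_option linter.unusedSectionVars false

namespace DigraphParking

/-- A partition of the vertices into paths along `par`, with `z` forming a path of its own.
`lab v` names the path of `v`, which has `len (lab v)` vertices, `pos v` of them strictly above `v`
(reached from `v` by iterating `par`) and `cop v` of them strictly below. -/
structure PathCover {V : Type*} (par : V → V) (z : V) where
  lab : V → V
  pos : V → ℕ
  cop : V → ℕ
  len : V → ℕ
  pos_add_cop : ∀ v, pos v + cop v + 1 = len (lab v)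
  eq_of_pos : ∀ {u v}, lab u = lab v → pos u = pos v → u = v
  exists_pos : ∀ v k, k < len (lab v) → ∃ u, lab u = lab v ∧ pos u = k
  lab_par : ∀ v, pos v ≠ 0 → lab (par v) = lab v
  pos_par : ∀ v, pos v ≠ 0 → pos (par v) + 1 = pos v
  eq_root : ∀ v, lab v = lab z → v = z

theorem isParkingFunction_of_card_le {V : Type*} [Fintype V] [DecidableEq V]
    {D : Digraph V} {par : V → V} {z : V}
    (hpar : ∀ u, u ≠ z → D.Adj u (par u)) (hz : par z = z) {m : ℕ} {s : Fin m → V}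
    (h : ∀ R : Finset V, (∀ v ∈ R, par v ∈ R) →
      (Finset.univ.filter fun i => s i ∈ R).card ≤ R.card) : IsParkingFunction D s := by
  classical
  refine allCarsPark_of_countP_le hpar hz _ _ fun R hR => ?_
  have h1 := countP_ofFn_eq_card (· ∈ R) s
  have h2 := h R hR
  rw [← h1] at h2
  convert h2 using 1
  · congr!
  · simp

namespace PathCover

variable {V : Type*} [Fintype V] [DecidableEq V] {par : V → V} {z : V} (C : PathCover par z)
  {m : ℕ}

/-- No path other than that of the root has more cars in a top segment than there are vertices. -/
def TopOK (s : Fin m → V) : Prop :=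
  ∀ a, a ≠ C.lab z → ∀ k,
    (Finset.univ.filter fun i => C.lab (s i) = a ∧ C.pos (s i) < k).card ≤ k

/-- No path other than that of the root has more cars in a bottom segment than there are
vertices. -/
def BotOK (s : Fin m → V) : Prop :=
  ∀ a, a ≠ C.lab z → ∀ k,
    (Finset.univ.filter fun i => C.lab (s i) = a ∧ C.cop (s i) < k).card ≤ k

open Classical in
/-- Reversing all paths turns bottom segments into top segments. -/
theorem card_botOK_le_card_topOK :
    (Finset.univ.filter fun s : Fin m → V => C.BotOK s).card ≤
      (Finset.univ.filter fun s : Fin m → V => C.TopOK s).card := by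
  have hex : ∀ v, ∃ u, C.lab u = C.lab v ∧ C.pos u = C.cop v := fun v =>
    C.exists_pos v _ (by have := C.pos_add_cop v; omega)
  choose ρ hlab hpos using hex
  have hinj : Function.Injective ρ := by
    intro u v huv
    have h1 : C.lab u = C.lab v := by rw [← hlab u, ← hlab v, huv]
    refine C.eq_of_pos h1 ?_
    have h2 := hpos u
    have h3 := hpos v
    have h4 := C.pos_add_cop u
    have h5 := C.pos_add_cop v
    rw [huv] at h2
    rw [h1] at h4
    omega
  refine Finset.card_le_card_of_injOn (fun s i => ρ (s i)) ?_ ?_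
  · intro s hs
    simp only [Finset.coe_filter, Finset.mem_univ, true_and, Set.mem_ofPred_eq] at hs ⊢
    intro a ha k
    simpa only [hlab, hpos] using hs a ha k
  · intro s _ t _ hst
    funext i
    exact hinj (congrFun hst i)

theorem pos_lt_card {R : Finset V} (hR : ∀ v ∈ R, par v ∈ R) {v : V} (hv : v ∈ R) :
    C.pos v < (R.filter fun u => C.lab u = C.lab v).card := by
  have key : ∀ j ≤ C.pos v, par^[j] v ∈ R ∧ C.lab (par^[j] v) = C.lab v ∧
      C.pos (par^[j] v) = C.pos v - j := by
    intro j
    induction j with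
    | zero => intro _; exact ⟨hv, rfl, rfl⟩
    | succ j ih =>
      intro hj
      obtain ⟨h1, h2, h3⟩ := ih (by omega)
      have h0 : C.pos (par^[j] v) ≠ 0 := by omega
      have h4 := C.pos_par _ h0
      rw [Function.iterate_succ_apply']
      exact ⟨hR _ h1, (C.lab_par _ h0).trans h2, by omega⟩
  rw [← Nat.succ_le_iff, ← Finset.card_range (C.pos v).succ]
  refine Finset.card_le_card_of_injOn (fun j => par^[j] v) ?_ ?_
  · intro j hj
    have hj' : j ≤ C.pos v := by simpa [Nat.lt_succ_iff] using hj
    simp [key j hj']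
  · intro i hi j hj hij
    have hi' : i ≤ C.pos v := by simpa [Nat.lt_succ_iff] using hi
    have hj' : j ≤ C.pos v := by simpa [Nat.lt_succ_iff] using hj
    have h1 := (key i hi').2.2
    have h2 := (key j hj').2.2
    simp only at hij
    rw [hij] at h1
    omega

theorem card_fiber_le {R : Finset V} (hR : ∀ v ∈ R, par v ∈ R) {s : Fin m → V} {a : V} {e : ℕ}
    (h : ∀ k, (Finset.univ.filter fun i => C.lab (s i) = a ∧ C.pos (s i) < k).card ≤ k + e) :
    (Finset.univ.filter fun i => s i ∈ R ∧ C.lab (s i) = a).card ≤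
      (R.filter fun u => C.lab u = a).card + e := by
  refine le_trans (Finset.card_le_card ?_) (h _)
  intro i hi
  simp only [Finset.mem_filter, Finset.mem_univ, true_and] at hi ⊢
  refine ⟨hi.2, ?_⟩
  rw [← hi.2]
  exact C.pos_lt_card hR hi.1

theorem card_eq_sum_fiber (R : Finset V) (s : Fin m → V) :
    (Finset.univ.filter fun i => s i ∈ R).card =
      ∑ a, (Finset.univ.filter fun i => s i ∈ R ∧ C.lab (s i) = a).card := by
  rw [Finset.card_eq_sum_card_fiberwise (f := fun i => C.lab (s i)) (t := Finset.univ)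
    (by intro i _; simp)]
  simp only [Finset.filter_filter]

theorem card_eq_sum_lab (R : Finset V) :
    R.card = ∑ a, (R.filter fun u => C.lab u = a).card :=
  Finset.card_eq_sum_card_fiberwise (by intro i _; simp)

variable {D : Digraph V}

theorem TopOK.isParkingFunction (hpar : ∀ u, u ≠ z → D.Adj u (par u)) (hz : par z = z)
    {s : Fin m → V} (hs : C.TopOK s) (hc : (Finset.univ.filter fun i => s i = z).card ≤ 1) :
    IsParkingFunction D s := by
  refine isParkingFunction_of_card_le hpar hz fun R hR => ?_
  rw [C.card_eq_sum_fiber, C.card_eq_sum_lab R]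
  refine Finset.sum_le_sum fun a _ => C.card_fiber_le (e := 0) hR fun k => ?_
  by_cases ha : a = C.lab z
  · rcases Nat.eq_zero_or_pos k with rfl | hk
    · simp
    · refine le_trans (Finset.card_le_card ?_) (hc.trans hk)
      intro i hi
      simp only [Finset.mem_filter, Finset.mem_univ, true_and] at hi ⊢
      exact C.eq_root _ (hi.1.trans ha)
  · exact hs a ha k

/-- The number of cars before `i` that prefer `z`. -/
def rank (z : V) (s : Fin m → V) (i : Fin m) : ℕ :=
  (Finset.univ.filter fun j => j < i ∧ s j = z).card

theorem rank_lt_rank {s : Fin m → V} {i j : Fin m} (hi : s i = z) (hij : i < j) :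
    rank z s i < rank z s j := by
  refine Finset.card_lt_card (Finset.ssubset_iff_of_subset ?_ |>.2 ⟨i, ?_, ?_⟩)
  · intro k hk
    simp only [Finset.mem_filter, Finset.mem_univ, true_and] at hk ⊢
    exact ⟨hk.1.trans hij, hk.2⟩
  · simp [hi, hij]
  · simp

theorem rank_le (s : Fin m → V) (i : Fin m) : rank z s i ≤ i := by
  calc rank z s i ≤ (Finset.Iio i).card := Finset.card_le_card fun j hj => by
        simp only [Finset.mem_filter, Finset.mem_univ, true_and, Finset.mem_Iio] at hj ⊢
        exact hj.1
    _ = i := by simp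

open Classical in
/-- The vertex at position `k` on the path of `x`. -/
noncomputable def vert (x : V) (k : ℕ) : V :=
  if h : k < C.len (C.lab x) then (C.exists_pos x k h).choose else x

theorem lab_vert (x : V) (k : ℕ) : C.lab (C.vert x k) = C.lab x := by
  unfold vert
  split_ifs with h
  · exact (C.exists_pos x k h).choose_spec.1
  · rfl

theorem pos_vert {x : V} {k : ℕ} (h : k < C.len (C.lab x)) : C.pos (C.vert x k) = k := by
  unfold vert
  rw [dif_pos h]
  exact (C.exists_pos x k h).choose_spec.2

/-- Move the cars that prefer `z` to the path of `x`: the first two of them to its top vertex, the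
others to the following vertices. -/
noncomputable def move (s : Fin m → V) (x : V) (i : Fin m) : V :=
  if s i = z then C.vert x (rank z s i - 1) else s i

/-- A child of the root whose path is long enough to take `m - 1` cars. -/
structure IsHead (m : ℕ) (x : V) : Prop where
  ne : x ≠ z
  par_eq : par x = z
  pos_eq : C.pos x = 0
  le_len : m - 1 ≤ C.len (C.lab x)

variable {C}

theorem pos_move (hm : 2 ≤ m) {x : V} (hx : C.IsHead m x) {s : Fin m → V} {i : Fin m}
    (hi : s i = z) : C.pos (C.move s x i) = rank z s i - 1 := by
  rw [move, if_pos hi]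
  refine C.pos_vert ?_
  have h1 := rank_le (z := z) s i
  have h2 := i.2
  have h3 := hx.le_len
  omega

theorem lab_move_of_eq {s : Fin m → V} {i : Fin m} (hi : s i = z) (x : V) :
    C.lab (C.move s x i) = C.lab x := by
  rw [move, if_pos hi, C.lab_vert]

theorem move_of_ne {s : Fin m → V} {i : Fin m} (hi : s i ≠ z) (x : V) :
    C.move s x i = s i := by
  rw [move, if_neg hi]

theorem IsHead.lab_ne {x : V} (hx : C.IsHead m x) : C.lab x ≠ C.lab z :=
  fun h => hx.ne (C.eq_root _ h)

theorem move_ne_root {x : V} (hx : C.IsHead m x) (s : Fin m → V) (i : Fin m) :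
    C.lab (C.move s x i) ≠ C.lab z := by
  by_cases hi : s i = z
  · rw [lab_move_of_eq hi]; exact hx.lab_ne
  · rw [move_of_ne hi]; exact fun h => hi (C.eq_root _ h)

theorem two_le_card_move (hm : 2 ≤ m) {x : V} (hx : C.IsHead m x) {s : Fin m → V}
    (hc : 2 ≤ (Finset.univ.filter fun i => s i = z).card) :
    2 ≤ (Finset.univ.filter fun i => C.move s x i = x).card := by
  set S := Finset.univ.filter fun i => s i = z with hS
  have hS1 : S.Nonempty := Finset.card_pos.1 (by omega)
  set i := S.min' hS1 with hi
  have hiS : i ∈ S := S.min'_mem hS1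
  have hS2 : (S.erase i).Nonempty :=
    Finset.card_pos.1 (by rw [Finset.card_erase_of_mem hiS]; omega)
  set j := (S.erase i).min' hS2 with hj
  have hjS : j ∈ S.erase i := (S.erase i).min'_mem hS2
  have hle : ∀ k, s k = z → i ≤ k := fun k hk => S.min'_le k (by simp [hS, hk])
  have hle2 : ∀ k, s k = z → k ≠ i → j ≤ k := fun k hk hki =>
    (S.erase i).min'_le k (by simp [hS, hk, hki])
  have hat : ∀ k, s k = z → rank z s k ≤ 1 → C.move s x k = x := by
    intro k hk hr
    refine C.eq_of_pos (lab_move_of_eq hk x) ?_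
    rw [pos_move hm hx hk, hx.pos_eq]
    omega
  have hri : rank z s i ≤ 1 := by
    refine (Finset.card_eq_zero.2 ?_).trans_le zero_le_one
    refine Finset.filter_eq_empty_iff.2 fun k _ hk => ?_
    exact absurd (hle k hk.2) (not_le.2 hk.1)
  have hrj : rank z s j ≤ 1 := by
    rw [← Finset.card_singleton i]
    refine Finset.card_le_card fun k hk => ?_
    simp only [Finset.mem_filter, Finset.mem_univ, true_and] at hk
    rw [Finset.mem_singleton]
    by_contra hki
    exact absurd (hle2 k hk.2 hki) (not_le.2 hk.1)
  have hji : j ≠ i := Finset.ne_of_mem_erase hjS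
  have hjz : s j = z := (Finset.mem_filter.1 (Finset.mem_of_mem_erase hjS)).2
  have hiz : s i = z := (Finset.mem_filter.1 hiS).2
  rw [← Finset.card_pair hji]
  refine Finset.card_le_card fun k hk => ?_
  simp only [Finset.mem_insert, Finset.mem_singleton] at hk
  simp only [Finset.mem_filter, Finset.mem_univ, true_and]
  rcases hk with rfl | rfl
  · exact hat _ hjz hrj
  · exact hat _ hiz hri

theorem TopOK.card_eq_head_le {x : V} (hx : C.IsHead m x) {s : Fin m → V} (hs : C.TopOK s) :
    (Finset.univ.filter fun i => s i = x).card ≤ 1 := by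
  refine le_trans (Finset.card_le_card ?_) (hs (C.lab x) hx.lab_ne 1)
  intro i hi
  simp only [Finset.mem_filter, Finset.mem_univ, true_and] at hi ⊢
  rw [hi, hx.pos_eq]
  exact ⟨rfl, zero_lt_one⟩

theorem not_topOK_move (hm : 2 ≤ m) {x : V} (hx : C.IsHead m x) {s : Fin m → V}
    (hc : 2 ≤ (Finset.univ.filter fun i => s i = z).card) : ¬ C.TopOK (C.move s x) := by
  intro h
  have h1 := h.card_eq_head_le hx
  have h2 := two_le_card_move hm hx hc
  omega

theorem move_injective (hm : 2 ≤ m) {x y : V} (hx : C.IsHead m x) (hy : C.IsHead m y)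
    {s t : Fin m → V} (hs : C.TopOK s)
    (hct : 2 ≤ (Finset.univ.filter fun i => t i = z).card)
    (hsx : ∀ i, C.lab (s i) ≠ C.lab x) (hty : ∀ i, C.lab (t i) ≠ C.lab y)
    (h : C.move s x = C.move t y) : s = t ∧ x = y := by
  have hxy : x = y := by
    by_contra hne
    have hlab : C.lab x ≠ C.lab y := fun h' =>
      hne (C.eq_of_pos h' (by rw [hx.pos_eq, hy.pos_eq]))
    have h1 := two_le_card_move hm hy hct
    rw [← h] at h1
    have h2 := hs.card_eq_head_le hy
    have h3 : (Finset.univ.filter fun i => C.move s x i = y).card ≤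
        (Finset.univ.filter fun i => s i = y).card := by
      refine Finset.card_le_card fun i hi => ?_
      simp only [Finset.mem_filter, Finset.mem_univ, true_and] at hi ⊢
      by_cases hiz : s i = z
      · have h4 := lab_move_of_eq (C := C) hiz x
        rw [hi] at h4
        exact absurd h4.symm hlab
      · rwa [move_of_ne hiz] at hi
    omega
  subst hxy
  refine ⟨funext fun i => ?_, rfl⟩
  have hi := congrFun h i
  by_cases h1 : s i = z <;> by_cases h2 : t i = z
  · rw [h1, h2]
  · have h3 := lab_move_of_eq (C := C) h1 x
    rw [hi, move_of_ne h2] at h3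
    exact absurd h3 (hty i)
  · have h3 := lab_move_of_eq (C := C) h2 x
    rw [← hi, move_of_ne h1] at h3
    exact absurd h3 (hsx i)
  · rwa [move_of_ne h1, move_of_ne h2] at hi

theorem isParkingFunction_move (hpar : ∀ u, u ≠ z → D.Adj u (par u)) (hz : par z = z)
    (hm : 2 ≤ m) {x : V} (hx : C.IsHead m x) {s : Fin m → V} (hs : C.TopOK s)
    (hsx : ∀ i, C.lab (s i) ≠ C.lab x) : IsParkingFunction D (C.move s x) := by
  refine isParkingFunction_of_card_le hpar hz fun R hR => ?_
  rw [C.card_eq_sum_fiber, C.card_eq_sum_lab R]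
  have hother : ∀ a, a ≠ C.lab x → a ≠ C.lab z →
      (Finset.univ.filter fun i => C.move s x i ∈ R ∧ C.lab (C.move s x i) = a).card ≤
        (R.filter fun u => C.lab u = a).card := by
    intro a hax haz
    refine C.card_fiber_le (e := 0) hR fun k => le_trans (Finset.card_le_card ?_) (hs a haz k)
    intro i hi
    simp only [Finset.mem_filter, Finset.mem_univ, true_and] at hi ⊢
    by_cases hiz : s i = z
    · exact absurd ((lab_move_of_eq hiz x).symm.trans hi.1).symm hax
    · rwa [move_of_ne hiz] at hi
  have hroot : (Finset.univ.filter fun i => C.move s x i ∈ R ∧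
      C.lab (C.move s x i) = C.lab z).card = 0 := by
    rw [Finset.card_eq_zero, Finset.filter_eq_empty_iff]
    exact fun i _ hi => move_ne_root hx s i hi.2
  have hpath : (Finset.univ.filter fun i => C.move s x i ∈ R ∧
      C.lab (C.move s x i) = C.lab x).card ≤ (R.filter fun u => C.lab u = C.lab x).card + 1 := by
    refine C.card_fiber_le hR fun k => ?_
    rw [← Finset.card_range (k + 1)]
    have hz' : ∀ i, C.lab (C.move s x i) = C.lab x → s i = z := by
      intro i hi
      by_contra hiz
      rw [move_of_ne hiz] at hi
      exact hsx i hi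
    refine Finset.card_le_card_of_injOn (rank z s) ?_ ?_
    · intro i hi
      simp only [Finset.coe_filter, Finset.mem_univ, true_and, Set.mem_ofPred_eq] at hi
      have h1 := hi.2
      rw [pos_move hm hx (hz' i hi.1)] at h1
      simp only [Finset.coe_range, Set.mem_Iio]
      omega
    · intro i hi j hj hij
      simp only [Finset.coe_filter, Finset.mem_univ, true_and, Set.mem_ofPred_eq] at hi hj
      rcases lt_trichotomy i j with h | h | h
      · exact absurd hij (rank_lt_rank (hz' i hi.1) h).ne
      · exact h
      · exact absurd hij (rank_lt_rank (hz' j hj.1) h).ne'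
  by_cases hzR : z ∈ R
  · have hone : 1 ≤ (R.filter fun u => C.lab u = C.lab z).card :=
      Finset.card_pos.2 ⟨z, by simp [hzR]⟩
    have hsum : ∑ a, ((Finset.univ.filter fun i => C.move s x i ∈ R ∧
          C.lab (C.move s x i) = a).card + if a = C.lab z then 1 else 0) ≤
        ∑ a, ((R.filter fun u => C.lab u = a).card + if a = C.lab x then 1 else 0) := by
      refine Finset.sum_le_sum fun a _ => ?_
      by_cases haz : a = C.lab z
      · rw [haz, hroot]
        simp only [if_true]
        omega
      · rw [if_neg haz]
        by_cases hax : a = C.lab x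
        · rw [hax]; simpa using hpath
        · rw [if_neg hax]
          exact hother a hax haz
    simpa [Finset.sum_add_distrib] using hsum
  · have hxR : ∀ v, v ∈ R → C.lab v ≠ C.lab x := by
      have hind : ∀ k v, C.pos v = k → v ∈ R → C.lab v ≠ C.lab x := by
        intro k
        induction k with
        | zero =>
          intro v hv hvR hl
          have hvx : v = x := C.eq_of_pos hl (by rw [hv, hx.pos_eq])
          subst hvx
          exact hzR (hx.par_eq ▸ hR _ hvR)
        | succ k ih =>
          intro v hv hvR hl
          have h0 : C.pos v ≠ 0 := by omega
          have h1 := C.pos_par v h0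
          exact ih (par v) (by omega) (hR v hvR) ((C.lab_par v h0).trans hl)
      exact fun v => hind _ v rfl
    refine Finset.sum_le_sum fun a _ => ?_
    by_cases haz : a = C.lab z
    · rw [haz, hroot]; exact Nat.zero_le _
    · by_cases hax : a = C.lab x
      · refine (Finset.card_eq_zero.2 ?_).trans_le (Nat.zero_le _)
        rw [Finset.filter_eq_empty_iff]
        exact fun i _ hi => hxR _ hi.1 (hi.2.trans hax)
      · exact hother a hax haz

theorem exists_free_head {X : Finset V} (hX : ∀ x ∈ X, C.IsHead m x) (hXm : m ≤ X.card)
    {s : Fin m → V} (hc : 1 ≤ (Finset.univ.filter fun i => s i = z).card) :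
    ∃ x ∈ X, ∀ i, C.lab (s i) ≠ C.lab x := by
  by_contra! hno
  have hsub : X.image C.lab ⊆ (Finset.univ.filter fun i => s i ≠ z).image fun i => C.lab (s i) := by
    intro a ha
    obtain ⟨x, hx, rfl⟩ := Finset.mem_image.1 ha
    obtain ⟨i, hi⟩ := hno x hx
    refine Finset.mem_image.2 ⟨i, ?_, hi⟩
    simp only [Finset.mem_filter, Finset.mem_univ, true_and]
    intro hiz
    rw [hiz] at hi
    exact (hX x hx).lab_ne hi.symm
  have hinj : (X.image C.lab).card = X.card := Finset.card_image_of_injOn fun x hx y hy hxy =>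
    C.eq_of_pos hxy (by rw [(hX x hx).pos_eq, (hX y hy).pos_eq])
  have h1 := (Finset.card_le_card hsub).trans Finset.card_image_le
  have h2 := Finset.card_filter_add_card_filter_not (s := Finset.univ) (fun i : Fin m => s i = z)
  rw [Finset.card_univ, Fintype.card_fin] at h2
  simp only [ne_eq] at h1
  omega

open Classical in
theorem card_topOK_lt (hpar : ∀ u, u ≠ z → D.Adj u (par u)) (hz : par z = z) (hm : 2 ≤ m)
    {X : Finset V} (hX : ∀ x ∈ X, C.IsHead m x) (hXm : m ≤ X.card) :
    (Finset.univ.filter fun s : Fin m → V => C.TopOK s).card <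
      (Finset.univ.filter fun s : Fin m → V => IsParkingFunction D s).card := by
  have hfree : ∀ s : Fin m → V, ∃ x, 2 ≤ (Finset.univ.filter fun i => s i = z).card →
      x ∈ X ∧ ∀ i, C.lab (s i) ≠ C.lab x := by
    intro s
    by_cases hc : 2 ≤ (Finset.univ.filter fun i => s i = z).card
    · obtain ⟨x, h⟩ := exists_free_head hX hXm (s := s) (by omega)
      exact ⟨x, fun _ => h⟩
    · exact ⟨z, fun h => absurd h hc⟩
  choose x hx using hfree
  set N := Finset.univ.filter fun s : Fin m → V => C.TopOK s with hN
  set N₂ := N.filter fun s => 2 ≤ (Finset.univ.filter fun i => s i = z).card with hN₂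
  set N₁ := N.filter fun s => ¬ 2 ≤ (Finset.univ.filter fun i => s i = z).card with hN₁
  have hmem : ∀ s, s ∈ N₂ ↔ C.TopOK s ∧ 2 ≤ (Finset.univ.filter fun i => s i = z).card := by
    intro s; simp [hN₂, hN]
  have hmem₁ : ∀ s, s ∈ N₁ ↔ C.TopOK s ∧ ¬ 2 ≤ (Finset.univ.filter fun i => s i = z).card := by
    intro s; simp [hN₁, hN]
  have hcard : N₂.card + N₁.card = N.card := Finset.card_filter_add_card_filter_not _
  let s₀ : Fin m → V := fun _ => z
  have hs₀ : s₀ ∈ N₂ := by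
    rw [hmem]
    refine ⟨fun a ha k => ?_, by simpa [s₀] using hm⟩
    refine (Finset.card_eq_zero.2 ?_).trans_le (Nat.zero_le _)
    rw [Finset.filter_eq_empty_iff]
    exact fun i _ hi => ha hi.1.symm
  have hs₀x : ∀ y ∈ X, ∀ i, C.lab (s₀ i) ≠ C.lab y := fun y hy _ h => (hX y hy).lab_ne h.symm
  obtain ⟨y, hyX, hyne⟩ : ∃ y ∈ X, y ≠ x s₀ := Finset.exists_mem_ne (by omega) _
  have hinj : Set.InjOn (fun s => C.move s (x s)) N₂ := by
    intro s hs t ht hst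
    rw [Finset.mem_coe, hmem] at hs ht
    obtain ⟨h1, h2⟩ := hx s hs.2
    obtain ⟨h3, h4⟩ := hx t ht.2
    exact (move_injective hm (hX _ h1) (hX _ h3) hs.1 ht.2 h2 h4 hst).1
  have hnot : C.move s₀ y ∉ N₂.image fun s => C.move s (x s) := by
    intro h
    obtain ⟨s, hs, hst⟩ := Finset.mem_image.1 h
    have hs' := (hmem s).1 hs
    obtain ⟨h1, h2⟩ := hx s hs'.2
    obtain ⟨h3, h4⟩ := move_injective hm (hX _ h1) (hX _ hyX) hs'.1 ((hmem _).1 hs₀).2 h2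
      (hs₀x y hyX) hst
    rw [h3] at h4
    exact hyne h4.symm
  have himg : ∀ t ∈ insert (C.move s₀ y) (N₂.image fun s => C.move s (x s)),
      IsParkingFunction D t ∧ ¬ C.TopOK t := by
    intro t ht
    rcases Finset.mem_insert.1 ht with rfl | ht
    · have h := (hmem _).1 hs₀
      exact ⟨isParkingFunction_move hpar hz hm (hX y hyX) h.1 (hs₀x y hyX),
        not_topOK_move hm (hX y hyX) h.2⟩
    · obtain ⟨s, hs, rfl⟩ := Finset.mem_image.1 ht
      have h := (hmem s).1 hs
      obtain ⟨h1, h2⟩ := hx s h.2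
      exact ⟨isParkingFunction_move hpar hz hm (hX _ h1) h.1 h2, not_topOK_move hm (hX _ h1) h.2⟩
  have hdisj : Disjoint N₁ (insert (C.move s₀ y) (N₂.image fun s => C.move s (x s))) := by
    rw [Finset.disjoint_left]
    exact fun t ht ht' => (himg t ht').2 ((hmem₁ t).1 ht).1
  have hsub : N₁ ∪ insert (C.move s₀ y) (N₂.image fun s => C.move s (x s)) ⊆
      Finset.univ.filter fun s : Fin m → V => IsParkingFunction D s := by
    intro t ht
    refine Finset.mem_filter.2 ⟨Finset.mem_univ _, ?_⟩
    rcases Finset.mem_union.1 ht with ht | ht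
    · have h := (hmem₁ t).1 ht
      exact TopOK.isParkingFunction C hpar hz h.1 (by omega)
    · exact (himg t ht).1
  have hle := Finset.card_le_card hsub
  rw [Finset.card_union_of_disjoint hdisj, Finset.card_insert_of_notMem hnot,
    Finset.card_image_of_injOn hinj] at hle
  omega

end PathCover

theorem IsSinkTree.exists_parent {V : Type*} {T : Digraph V} {z : V} (hT : IsSinkTree T z) :
    ∃ par : V → V, par z = z ∧ ∀ u v, T.Adj u v ↔ u ≠ z ∧ par u = v := by
  classical
  obtain ⟨htree, hdist⟩ := hT
  have hne : ∀ u v, T.Adj u v → u ≠ z := by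
    rintro u v huv rfl
    have := hdist _ _ huv
    rw [SimpleGraph.dist_self] at this
    omega
  have hund : ∀ u v, T.Adj u v → (underlying T).Adj u v := by
    intro u v huv
    refine ⟨?_, Or.inl huv⟩
    rintro rfl
    have := hdist _ _ huv
    omega
  have hex : ∀ u, u ≠ z → ∃ v, T.Adj u v := by
    intro u hu
    obtain ⟨p, hp⟩ := htree.connected.exists_walk_length_eq_dist u z
    cases p with
    | nil => exact absurd rfl hu
    | @cons _ v _ h p =>
      refine ⟨v, h.2.resolve_right fun hvu => ?_⟩
      have h1 := hdist _ _ hvu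
      have h2 := SimpleGraph.dist_le p
      rw [SimpleGraph.Walk.length_cons] at hp
      omega
  have huniq : ∀ u v w, T.Adj u v → T.Adj u w → v = w := by
    intro u v w huv huw
    obtain ⟨p, hp⟩ := htree.connected.exists_walk_length_eq_dist v z
    obtain ⟨q, hq⟩ := htree.connected.exists_walk_length_eq_dist w z
    have hp' : (SimpleGraph.Walk.cons (hund _ _ huv) p).IsPath :=
      SimpleGraph.Walk.isPath_of_length_eq_dist _ (by simp [hp, hdist _ _ huv])
    have hq' : (SimpleGraph.Walk.cons (hund _ _ huw) q).IsPath :=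
      SimpleGraph.Walk.isPath_of_length_eq_dist _ (by simp [hq, hdist _ _ huw])
    have h := (htree.existsUnique_path u z).unique hp' hq'
    simpa using congrArg SimpleGraph.Walk.snd h
  choose f hf using hex
  refine ⟨fun u => if h : u = z then z else f u h, by simp, fun u v => ⟨fun h => ?_, ?_⟩⟩
  · have hu := hne u v h
    exact ⟨hu, by simpa [hu] using huniq _ _ _ (hf u hu) h⟩
  · rintro ⟨hu, rfl⟩
    simpa [hu] using hf u hu

/-- The vertices of a finite rooted tree are covered by vertical paths: each vertex other than the
root lies on the path of the smallest leaf below it. -/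
theorem exists_pathCover {V : Type*} [Fintype V] [LinearOrder V] {par : V → V} {z : V}
    (hz : par z = z) {d : V → ℕ} (hdz : ∀ v, d v = 0 ↔ v = z) (hd : ∀ v, d (par v) = d v - 1) :
    ∃ C : PathCover par z, (∀ v, v ≠ z → ∀ u, u ≠ z → par u ≠ C.lab v) ∧
      (∀ v, par^[C.cop v] (C.lab v) = v) ∧
      ∀ x, x ≠ z → par x = z → C.pos x = 0 ∧ C.len (C.lab x) = d (C.lab x) := by
  classical
  have hdi : ∀ j v, d (par^[j] v) = d v - j := by
    intro j
    induction j with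
    | zero => simp
    | succ j ih => intro v; rw [Function.iterate_succ_apply', hd, ih]; omega
  have hleaf : ∀ v, ∃ l, ((∀ u, u ≠ z → par u ≠ l) ∧ ∃ j, par^[j] l = v) ∧
      ∀ l', (∀ u, u ≠ z → par u ≠ l') → (∃ j, par^[j] l' = v) → l ≤ l' := by
    intro v
    have hne : (Finset.univ.filter fun l =>
        (∀ u, u ≠ z → par u ≠ l) ∧ ∃ j, par^[j] l = v).Nonempty := by
      obtain ⟨l, hl, hmax⟩ := Finset.exists_max_image
        (Finset.univ.filter fun l => ∃ j, par^[j] l = v) d ⟨v, by simp; exact ⟨0, rfl⟩⟩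
      simp only [Finset.mem_filter, Finset.mem_univ, true_and] at hl hmax
      refine ⟨l, by
        simp only [Finset.mem_filter, Finset.mem_univ, true_and]
        refine ⟨?_, hl⟩
        rintro u hu rfl
        obtain ⟨j, hj⟩ := hl
        have h1 := hmax u ⟨j + 1, hj⟩
        rw [hd] at h1
        have h2 := mt (hdz u).1 hu
        omega⟩
    obtain ⟨l, hl, hmin⟩ := Finset.exists_min_image _ id hne
    simp only [Finset.mem_filter, Finset.mem_univ, true_and, id] at hl hmin
    exact ⟨l, hl, fun l' h1 h2 => hmin l' ⟨h1, h2⟩⟩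
  choose leaf hleaf hmin using hleaf
  let lab : V → V := fun v => if v = z then z else leaf v
  have labz : lab z = z := if_pos rfl
  have labne : ∀ {v}, v ≠ z → lab v = leaf v := fun h => if_neg h
  have hex : ∀ l, ∃ j, ¬ (par^[j] l ≠ z ∧ leaf (par^[j] l) = l) := fun l =>
    ⟨d l, fun h => h.1 ((hdz _).1 (by rw [hdi]; omega))⟩
  let len : V → ℕ := fun l => if l = z then 1 else Nat.find (hex l)
  let cop : V → ℕ := fun v => d (lab v) - d v
  have hcop : ∀ v, par^[cop v] (lab v) = v := by
    intro v
    by_cases hv : v = z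
    · subst hv; rw [labz]; exact Function.iterate_fixed hz _
    · obtain ⟨j, hj⟩ := (hleaf v).2
      have h1 := hdi j (leaf v)
      rw [hj] at h1
      have h2 := mt (hdz v).1 hv
      have h3 : cop v = j := by
        simp only [cop, labne hv]; omega
      rw [h3, labne hv, hj]
  have hroot : ∀ v, lab v = z → v = z := by
    intro v hv
    have := hcop v
    rw [hv, Function.iterate_fixed hz] at this
    exact this.symm
  have hlt : ∀ v, cop v < len (lab v) := by
    intro v
    by_cases hv : v = z
    · subst hv; simp [cop, len, labz]
    · have h0 : lab v ≠ z := fun h => hv (hroot v h)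
      simp only [len, if_neg h0]
      rw [Nat.lt_find_iff]
      intro i hi
      rw [not_not]
      have hup : par^[cop v - i] (par^[i] (lab v)) = v := by
        rw [← Function.iterate_add_apply, Nat.sub_add_cancel hi, hcop]
      refine ⟨fun h => ?_, le_antisymm ?_ ?_⟩
      · rw [h, Function.iterate_fixed hz] at hup
        exact hv hup.symm
      · refine hmin _ _ ?_ ⟨i, rfl⟩
        rw [labne hv]; exact (hleaf v).1
      · rw [labne hv]
        refine hmin _ _ (hleaf _).1 ?_
        obtain ⟨j, hj⟩ := (hleaf (par^[i] (leaf v))).2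
        refine ⟨cop v - i + j, ?_⟩
        rw [Function.iterate_add_apply, hj, ← labne hv, hup]
  have hvert : ∀ v j, j < len (lab v) →
      lab (par^[j] (lab v)) = lab v ∧ cop (par^[j] (lab v)) = j := by
    intro v j hj
    by_cases hv : v = z
    · subst hv
      rw [labz] at hj ⊢
      have h0 : j = 0 := by simpa [len] using hj
      subst h0
      simp [labz, cop]
    · have h0 : lab v ≠ z := fun h => hv (hroot v h)
      simp only [len, if_neg h0] at hj
      obtain ⟨h1, h2⟩ := not_not.1 (Nat.find_min (hex (lab v)) hj)
      have h3 : lab (par^[j] (lab v)) = lab v := by rw [labne h1, h2]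
      refine ⟨h3, ?_⟩
      have h4 := mt (hdz _).1 h1
      simp only [cop, h3]
      rw [hdi] at h4 ⊢
      omega
  refine ⟨⟨lab, fun v => len (lab v) - 1 - cop v, cop, len, ?_, ?_, ?_, ?_, ?_, ?_⟩, ?_, hcop, ?_⟩
  · intro v
    have := hlt v
    omega
  · intro u v h1 h2
    have h3 := hlt u
    have h4 := hlt v
    simp only [h1] at h2 h3
    rw [← hcop u, ← hcop v, h1, show cop u = cop v by omega]
  · intro v k hk
    obtain ⟨h1, h2⟩ := hvert v (len (lab v) - 1 - k) (by omega)
    refine ⟨_, h1, ?_⟩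
    simp only [h1, h2]
    omega
  · intro v hv
    have h1 := (hvert v (cop v + 1) (by omega)).1
    rwa [Function.iterate_succ_apply', hcop] at h1
  · intro v hv
    have h1 := hvert v (cop v + 1) (by omega)
    rw [Function.iterate_succ_apply', hcop] at h1
    simp only [h1.1, h1.2]
    omega
  · intro v hv
    exact hroot v (hv.trans labz)
  · intro v hv
    simp only [labne hv]
    exact (hleaf v).1
  · intro x hx hpx
    have h0 : lab x ≠ z := fun h => hx (hroot x h)
    have h1 : len (lab x) ≤ d (lab x) := by
      simp only [len, if_neg h0]
      exact Nat.find_min' (hex (lab x)) fun h => h.1 ((hdz _).1 (by rw [hdi]; omega))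
    have h2 := hlt x
    have h3 := hd x
    rw [hpx, (hdz z).2 rfl] at h3
    have h4 : cop x = d (lab x) - d x := rfl
    have h5 := mt (hdz x).1 hx
    simp only
    omega

theorem card_le_of_mem_nbhd {V : Type*} [Finite V] {T : Digraph V} {v : V} (S : Finset V)
    (hS : ∀ u ∈ S, u ∈ nbhd T v) : S.card ≤ deg T v := by
  rw [deg, ← Set.ncard_coe_finset]
  exact Set.ncard_le_ncard (fun u hu => hS u hu) (Set.toFinite _)

theorem le_of_le_minleafdist {V : Type*} {T : Digraph V} {par : V → V} {m j : ℕ} {l : V}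
    (hm : (m : ℕ∞) ≤ minleafdist T) (hadj : ∀ u, u = par u ∨ (underlying T).Adj u (par u))
    (hl : deg T l = 1) (hdeg : 3 ≤ deg T (par^[j] l)) : m ≤ j + 1 := by
  have hdist : ∀ j : ℕ, (underlying T).edist l (par^[j] l) ≤ j := by
    intro j
    induction j with
    | zero => simp
    | succ j ih =>
      rw [Function.iterate_succ_apply']
      refine (SimpleGraph.edist_triangle (v := par^[j] l)).trans ?_
      push_cast
      exact add_le_add ih (SimpleGraph.edist_le_one_iff_adj_or_eq.2 (hadj _).symm)
  have h1 : minleafdist T ≤ (underlying T).edist l (par^[j] l) + 1 :=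
    iInf₂_le_of_le l hl (iInf₂_le_of_le (par^[j] l) hdeg le_rfl)
  have h2 := (hm.trans h1).trans (add_le_add_left (hdist j) 1)
  exact_mod_cast h2

theorem numParking_eq_card {V : Type*} [Fintype V] (D : Digraph V) (m : ℕ)
    [DecidablePred fun s : Fin m → V => IsParkingFunction D s] [Fintype (Fin m → V)] :
    numParking D m = (Finset.univ.filter fun s : Fin m → V => IsParkingFunction D s).card := by
  rw [numParking, ← Set.ncard_coe_finset]
  simp

theorem numParking_reversal_lt {V : Type*} [Fintype V] [LinearOrder V] {m : ℕ} {T : Digraph V}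
    {z : V} (hT : IsSinkTree T z) (hm : 2 ≤ m) (hdeg : m ≤ deg T z)
    (hmin : (m : ℕ∞) ≤ minleafdist T) : numParking (reversal T) m < numParking T m := by
  classical
  obtain ⟨par, hz, hpar⟩ := hT.exists_parent
  have hconn := hT.1.connected
  let d : V → ℕ := fun v => (underlying T).dist v z
  have hdz : ∀ v, d v = 0 ↔ v = z := fun v => hconn.dist_eq_zero_iff
  have hstep : ∀ v, v ≠ z → d v = d (par v) + 1 := fun v hv => hT.2 _ _ ((hpar _ _).2 ⟨hv, rfl⟩)
  have hd : ∀ v, d (par v) = d v - 1 := by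
    intro v
    by_cases hv : v = z
    · rw [hv, hz, (hdz z).2 rfl]
    · rw [hstep v hv]; rfl
  have hund : ∀ u, u ≠ z → (underlying T).Adj u (par u) := by
    intro u hu
    refine ⟨fun h => ?_, Or.inl ((hpar _ _).2 ⟨hu, rfl⟩)⟩
    have := hstep u hu
    rw [← h] at this
    omega
  have hadj : ∀ u, u = par u ∨ (underlying T).Adj u (par u) := by
    intro u
    by_cases hu : u = z
    · left; rw [hu, hz]
    · exact Or.inr (hund u hu)
  have hnb : ∀ u v, u ∈ nbhd T v → (v ≠ z ∧ par v = u) ∨ (u ≠ z ∧ par u = v) := by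
    rintro u v ⟨_, h | h⟩
    · exact Or.inl ((hpar _ _).1 h)
    · exact Or.inr ((hpar _ _).1 h)
  obtain ⟨C, hlf, hcop, hhead⟩ := exists_pathCover hz hdz hd
  have hlabz : ∀ v, v ≠ z → C.lab v ≠ z := by
    intro v hv h
    have := hcop v
    rw [h, Function.iterate_fixed hz] at this
    exact hv this.symm
  have hleaf : ∀ v, v ≠ z → deg T (C.lab v) = 1 := by
    intro v hv
    rw [deg, Set.ncard_eq_one]
    refine ⟨par (C.lab v), Set.eq_singleton_iff_unique_mem.2 ⟨hund _ (hlabz v hv), ?_⟩⟩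
    intro u hu
    rcases hnb _ _ hu with h | h
    · exact h.2.symm
    · exact absurd h.2 (hlf v hv u h.1)
  have hchild : ∀ u v, C.lab u ≠ C.lab z → C.cop u + 1 < m → v ≠ z → par v = u →
      C.lab v = C.lab u ∧ C.cop v < C.cop u := by
    intro u v hu hk hv hvu
    have huz : u ≠ z := fun h => hu (by rw [h])
    have hpc := C.pos_add_cop u
    rcases Nat.eq_zero_or_pos (C.cop u) with h0 | h0
    · have h1 := hcop u
      rw [h0, Function.iterate_zero_apply] at h1
      exact absurd (hvu.trans h1.symm) (hlf u huz v hv)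
    · obtain ⟨w, hw, hwp⟩ := C.exists_pos u (C.pos u + 1) (by omega)
      have hw0 : C.pos w ≠ 0 := by omega
      have hwu : par w = u :=
        C.eq_of_pos ((C.lab_par w hw0).trans hw) (by have := C.pos_par w hw0; omega)
      have hwz : w ≠ z := by
        rintro rfl
        exact hu hw.symm
      have hvw : v = w := by
        by_contra hne
        have h2 : deg T u ≥ 3 := by
          have h3 := hstep u huz
          have h4 := hstep v hv
          have h5 := hstep w hwz
          rw [hvu] at h4
          rw [hwu] at h5
          have h6 : par u ≠ v := fun h => by rw [h] at h3; omega
          have h7 : par u ≠ w := fun h => by rw [h] at h3; omega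
          rw [ge_iff_le, ← Finset.card_eq_three.2 ⟨par u, v, w, h6, h7, hne, rfl⟩]
          refine card_le_of_mem_nbhd _ fun y hy => ?_
          simp only [Finset.mem_insert, Finset.mem_singleton] at hy
          rcases hy with rfl | rfl | rfl
          · exact hund _ huz
          · exact hvu ▸ (hund _ hv).symm
          · exact hwu ▸ (hund _ hwz).symm
        rw [← hcop u] at h2
        have := le_of_le_minleafdist hmin hadj (hleaf u huz) h2
        omega
      subst hvw
      have := C.pos_add_cop v
      rw [hw] at this
      exact ⟨hw, by omega⟩
  have hbot : ∀ s : Fin m → V, IsParkingFunction (reversal T) s → C.BotOK s := by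
    intro s hs a ha k
    rcases Nat.lt_or_ge k m with hk | hk
    · let A : Finset V := Finset.univ.filter fun v => C.lab v = a ∧ C.cop v < k
      have hA : ∀ v, v ∈ A ↔ C.lab v = a ∧ C.cop v < k := by simp [A]
      have hcl : ∀ u ∈ A, ∀ v, (reversal T).Adj u v → v ∈ A := by
        intro u hu v huv
        obtain ⟨hv, hvu⟩ := (hpar _ _).1 huv
        obtain ⟨h1, h2⟩ := (hA u).1 hu
        obtain ⟨h3, h4⟩ := hchild u v (h1 ▸ ha) (by omega) hv hvu
        exact (hA v).2 ⟨h3.trans h1, by omega⟩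
      have h1 := AllCarsPark.countP_le A hcl hs
      have hAk : A.card ≤ k := by
        rw [← Finset.card_range k]
        refine Finset.card_le_card_of_injOn C.cop ?_ ?_
        · intro v hv
          simpa using ((hA v).1 hv).2
        · intro u hu v hv huv
          have h2 := (hA u).1 hu
          have h3 := (hA v).1 hv
          rw [← hcop u, ← hcop v, h2.1, h3.1, huv]
      calc _ = (Finset.univ.filter fun i => s i ∈ A).card := by simp only [hA]
        _ = (List.ofFn s).countP (fun v => v ∈ A) := (countP_ofFn_eq_card (· ∈ A) s).symm
        _ ≤ (A.filter (· ∉ (∅ : Set V))).card := by convert h1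
        _ ≤ A.card := Finset.card_filter_le _ _
        _ ≤ k := hAk
    · exact (Finset.card_le_univ _).trans (by simpa using hk)
  let X : Finset V := Finset.univ.filter fun x => x ≠ z ∧ par x = z
  have hXm : m ≤ X.card := by
    refine hdeg.trans ?_
    rw [deg, ← Set.ncard_coe_finset]
    refine Set.ncard_le_ncard (fun u hu => ?_) (Set.toFinite _)
    rcases hnb _ _ hu with h | h
    · exact absurd rfl h.1
    · simpa [X] using h
  have hX : ∀ x ∈ X, C.IsHead m x := by
    intro x hx
    obtain ⟨hxz, hpx⟩ : x ≠ z ∧ par x = z := by simpa [X] using hx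
    obtain ⟨h1, h2⟩ := hhead x hxz hpx
    refine ⟨hxz, hpx, h1, ?_⟩
    have h3 := C.pos_add_cop x
    rcases Nat.lt_or_ge m 3 with h4 | h4
    · omega
    · have h5 : par^[C.cop x + 1] (C.lab x) = z := by
        rw [Function.iterate_succ_apply', hcop, hpx]
      have h6 := le_of_le_minleafdist (j := C.cop x + 1) hmin hadj (hleaf x hxz)
        (by rw [h5]; omega)
      omega
  rw [numParking_eq_card, numParking_eq_card]
  refine lt_of_le_of_lt ?_
    (PathCover.card_topOK_lt (D := T) (fun u hu => (hpar _ _).2 ⟨hu, rfl⟩) hz hm hX hXm)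
  refine le_trans (Finset.card_le_card ?_) C.card_botOK_le_card_topOK
  intro s hs
  simp only [Finset.mem_filter, Finset.mem_univ, true_and] at hs ⊢
  exact hbot s hs

end DigraphParking

theorem mainTheorem3 (n m : ℕ) (T : Digraph (Fin n)) (z : Fin n)
    (hT : DigraphParking.IsSinkTree T z) (hm : 2 ≤ m)
    (hmin : (m : ℕ∞) ≤ min ((DigraphParking.nbhd T z).ncard : ℕ∞) (DigraphParking.minleafdist T)) :
    DigraphParking.numParking (DigraphParking.reversal T) m < DigraphParking.numParking T m :=
  DigraphParking.numParking_reversal_lt hT hm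
    (Nat.cast_le.1 (hmin.trans (min_le_left _ _))) (hmin.trans (min_le_right _ _))
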